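/- Let $\ell^2$ be the Hilbert space of square summable real sequences with its norm topology, and let $$\mathfrak{E}=\{(x_i)_{i\in\omega}\in\ell^2 : x_i\in\mathbb{Q}\text{ for all } i\in\omega\},\qquad \mathfrak{E}_{\mathrm c}=\{(x_i)_{i\in\omega}\in\ell^2 : x_i\in\{0\}\cup\{1/m : m=1,2,3,\dots\}\text{ for all } i\in\omega\}$$ be Erdős space and complete Erdős space, with the subspace topologies. For a space $X$ let $\mathcal{K}(X)$ be the hyperspace of nonempty compact subsets of $X$ with the Vietoris topology, and let $\mathcal{F}(X)$ and $\mathcal{F}_n(X)$ (for an integer $n\ge 1$) be its subspaces consisting of the nonempty finite subsets and of the nonempty subsets with at most $n$ points, respectively. A space is called *almost zero-dimensional* if every point has a neighbourhood base (of not necessarily open neighbourhoods) each of whose members is an intersection of clopen sets. A space is called *cohesive* if every point has a neighbourhood that contains no nonempty proper clopen subset of the space. **Corollary.** For every integer $n\ge 1$, the spaces $\mathcal{F}_n(\mathfrak{E}_{\mathrm c})$ and $\mathcal{F}_n(\mathfrak{E})$ are cohesive and almost zero-dimensional, and so are the spaces $\mathcal{F}(\mathfrak{E}_{\mathrm c})$,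 $\mathcal{F}(\mathfrak{E})$, $\mathcal{K}(\mathfrak{E}_{\mathrm c})$ and $\mathcal{K}(\mathfrak{E})$. -/

import Mathlib

open Topology TopologicalSpace

/-- The real Hilbert space `ℓ²` of square summable real sequences, with its norm topology. -/
abbrev HilbertL2 : Type := lp (fun _ : ℕ => ℝ) 2

/-- Erdős space: all points of `ℓ²` whose coordinates are all rational. -/
def erdosSpace : Set HilbertL2 :=
  {x | ∀ i : ℕ, ∃ q : ℚ, x i = (q : ℝ)}

/-- Complete Erdős space: all points of `ℓ²` whose coordinates all lie in
`{0} ∪ {1/m : m = 1, 2, 3, …}`. -/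
def completeErdosSpace : Set HilbertL2 :=
  {x | ∀ i : ℕ, x i = 0 ∨ ∃ m : ℕ, 1 ≤ m ∧ x i = 1 / (m : ℝ)}

/-- `𝒦(X)`, the hyperspace of nonempty compact subsets of `X`; it carries Mathlib's
Vietoris topology. -/
abbrev CompactHyperspace (X : Type*) [TopologicalSpace X] : Type _ := NonemptyCompacts X

/-- `ℱₙ(X)`, the subspace of `𝒦(X)` of the nonempty subsets with at most `n` points. -/
def symmetricProduct (n : ℕ) (X : Type*) [TopologicalSpace X] : Set (CompactHyperspace X) :=
  {K | (K : Set X).encard ≤ n}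

/-- `ℱ(X)`, the subspace of `𝒦(X)` of the nonempty finite subsets. -/
def finiteHyperspace (X : Type*) [TopologicalSpace X] : Set (CompactHyperspace X) :=
  {K | (K : Set X).Finite}

/-- A space is almost zero-dimensional if every point has a neighbourhood base whose members
are intersections of clopen sets (the members need not be open). -/
def IsAlmostZeroDimensional (X : Type*) [TopologicalSpace X] : Prop :=
  ∀ x : X, ∀ U ∈ 𝓝 x, ∃ V ∈ 𝓝 x, V ⊆ U ∧
    ∃ 𝒞 : Set (Set X), (∀ C ∈ 𝒞, IsClopen C) ∧ V = ⋂₀ 𝒞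

/-- A space is cohesive if every point has a neighbourhood that contains no nonempty proper
clopen subset of the space. -/
def IsCohesive (X : Type*) [TopologicalSpace X] : Prop :=
  ∀ x : X, ∃ U ∈ 𝓝 x, ¬ ∃ C : Set X, IsClopen C ∧ C.Nonempty ∧ C ≠ Set.univ ∧ C ⊆ U

/-! Both spaces consist of the points of ℓ² with coordinates in a countable set `S` containing every
1/m. Almost zero-dimensionality: finite partial sums of squared distances to a fixed point take
countably many values, so closed balls are intersections of clopen sets. Compactness carries this to
basic Vietoris neighbourhoods, and subspaces inherit it. Cohesion: by Erdős' argument, a nonempty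
clopen set of points is unbounded (`IsClopen.not_bounded_coordinateSubspace`). A nonempty clopen
family of compacta, pulled back along y ↦ {y} ∪ M, is such a set, so it has members reaching
arbitrarily far out; but the compacta near a given one all lie in one ball. -/

/-- Intersections of clopen sets, expressed through the separation of points from the set. -/
def IsClopenSeparated {X : Type*} [TopologicalSpace X] (V : Set X) : Prop :=
  ∀ z ∉ V, ∃ C : Set X, IsClopen C ∧ V ⊆ C ∧ z ∉ C

theorem isClopenSeparated_iff {X : Type*} [TopologicalSpace X] {V : Set X} :
    IsClopenSeparated V ↔ ∃ 𝒞 : Set (Set X), (∀ C ∈ 𝒞, IsClopen C) ∧ V = ⋂₀ 𝒞 := by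
  constructor
  · intro h
    refine ⟨{C | IsClopen C ∧ V ⊆ C}, fun C hC => hC.1, Set.Subset.antisymm ?_ ?_⟩
    · exact fun x hx C hC => hC.2 hx
    · intro x hx
      by_contra hxV
      obtain ⟨C, hC, hVC, hxC⟩ := h x hxV
      exact hxC (hx C ⟨hC, hVC⟩)
  · rintro ⟨𝒞, h𝒞, rfl⟩ z hz
    simp only [Set.mem_sInter, not_forall] at hz
    obtain ⟨C, hC, hzC⟩ := hz
    exact ⟨C, h𝒞 C hC, Set.sInter_subset_of_mem hC, hzC⟩

theorem isAlmostZeroDimensional_iff {X : Type*} [TopologicalSpace X] :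
    IsAlmostZeroDimensional X ↔
      ∀ x : X, ∀ U ∈ 𝓝 x, ∃ V ∈ 𝓝 x, V ⊆ U ∧ IsClopenSeparated V := by
  simp only [IsAlmostZeroDimensional, isClopenSeparated_iff]

theorem IsClopenSeparated.preimage {X Y : Type*} [TopologicalSpace X] [TopologicalSpace Y]
    {f : X → Y} (hf : Continuous f) {V : Set Y} (hV : IsClopenSeparated V) :
    IsClopenSeparated (f ⁻¹' V) := by
  intro z hz
  obtain ⟨C, hC, hVC, hzC⟩ := hV (f z) hz
  exact ⟨f ⁻¹' C, hC.preimage hf, Set.preimage_mono hVC, hzC⟩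

theorem IsClopenSeparated.union {X : Type*} [TopologicalSpace X] {V W : Set X}
    (hV : IsClopenSeparated V) (hW : IsClopenSeparated W) : IsClopenSeparated (V ∪ W) := by
  intro z hz
  rw [Set.mem_union, not_or] at hz
  obtain ⟨C, hC, hVC, hzC⟩ := hV z hz.1
  obtain ⟨D, hD, hWD, hzD⟩ := hW z hz.2
  exact ⟨C ∪ D, hC.union hD, Set.union_subset_union hVC hWD, by simp [hzC, hzD]⟩

/-- Finitely many of the clopen sets separating points of `L` from `V` suffice; intersect them. -/
theorem IsClopenSeparated.exists_isClopen_disjoint {X : Type*} [TopologicalSpace X] {V L : Set X}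
    (hV : IsClopenSeparated V) (hL : IsCompact L) (hLV : Disjoint L V) :
    ∃ D : Set X, IsClopen D ∧ V ⊆ D ∧ Disjoint L D := by
  refine hL.induction_on (p := fun s => ∃ D : Set X, IsClopen D ∧ V ⊆ D ∧ Disjoint s D)
    ⟨Set.univ, isClopen_univ, Set.subset_univ _, Set.empty_disjoint _⟩ ?_ ?_ ?_
  · rintro s t hst ⟨D, hD, hVD, htD⟩
    exact ⟨D, hD, hVD, htD.mono_left hst⟩
  · rintro s t ⟨D, hD, hVD, hsD⟩ ⟨E, hE, hVE, htE⟩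
    exact ⟨D ∩ E, hD.inter hE, Set.subset_inter hVD hVE, Set.disjoint_union_left.2
      ⟨hsD.mono_right Set.inter_subset_left, htE.mono_right Set.inter_subset_right⟩⟩
  · intro x hx
    obtain ⟨C, hC, hVC, hxC⟩ := hV x (Set.disjoint_left.1 hLV hx)
    exact ⟨Cᶜ, mem_nhdsWithin_of_mem_nhds (hC.compl.isOpen.mem_nhds hxC), C, hC, hVC,
      disjoint_compl_left⟩

theorem IsAlmostZeroDimensional.of_isInducing {X Y : Type*} [TopologicalSpace X]
    [TopologicalSpace Y] {f : X → Y} (hf : IsInducing f) (hY : IsAlmostZeroDimensional Y) :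
    IsAlmostZeroDimensional X := by
  rw [isAlmostZeroDimensional_iff] at hY ⊢
  intro x U hU
  rw [hf.nhds_eq_comap] at hU
  obtain ⟨T, hT, hTU⟩ := hU
  obtain ⟨V, hV, hVT, hVs⟩ := hY (f x) T hT
  exact ⟨f ⁻¹' V, hf.continuous.continuousAt hV, (Set.preimage_mono hVT).trans hTU,
    hVs.preimage hf.continuous⟩

theorem IsAlmostZeroDimensional.exists_mem_nhdsSet {X : Type*} [TopologicalSpace X]
    (hX : IsAlmostZeroDimensional X) {K O : Set X} (hK : IsCompact K) (hO : IsOpen O)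
    (hKO : K ⊆ O) : ∃ W : Set X, IsClopenSeparated W ∧ W ⊆ O ∧ K ⊆ interior W := by
  refine hK.induction_on
    (p := fun s => ∃ W : Set X, IsClopenSeparated W ∧ W ⊆ O ∧ s ⊆ interior W)
    ⟨∅, fun z _ => ⟨∅, isClopen_empty, subset_rfl, id⟩, Set.empty_subset _, Set.empty_subset _⟩
    ?_ ?_ ?_
  · rintro s t hst ⟨W, hW, hWO, htW⟩
    exact ⟨W, hW, hWO, hst.trans htW⟩
  · rintro s t ⟨V, hV, hVO, hsV⟩ ⟨W, hW, hWO, htW⟩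
    exact ⟨V ∪ W, hV.union hW, Set.union_subset hVO hWO, Set.union_subset
      (hsV.trans (interior_mono Set.subset_union_left))
      (htW.trans (interior_mono Set.subset_union_right))⟩
  · intro x hx
    obtain ⟨V, hV, hVO, hVs⟩ :=
      isAlmostZeroDimensional_iff.1 hX x O (hO.mem_nhds (hKO hx))
    exact ⟨interior V, mem_nhdsWithin_of_mem_nhds (interior_mem_nhds.2 hV), V, hVs, hVO,
      subset_rfl⟩

/-! ### Almost zero-dimensionality of the Vietoris hyperspace -/

theorem isClopen_subsets_of_isClopen {X : Type*} [TopologicalSpace X] {C : Set X}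
    (hC : IsClopen C) : IsClopen {L : CompactHyperspace X | (L : Set X) ⊆ C} :=
  ⟨NonemptyCompacts.isClosed_subsets_of_isClosed hC.isClosed,
    NonemptyCompacts.isOpen_subsets_of_isOpen hC.isOpen⟩

theorem isClopen_inter_nonempty_of_isClopen {X : Type*} [TopologicalSpace X] {C : Set X}
    (hC : IsClopen C) : IsClopen {L : CompactHyperspace X | ((L : Set X) ∩ C).Nonempty} :=
  ⟨NonemptyCompacts.isClosed_inter_nonempty_of_isClosed hC.isClosed,
    NonemptyCompacts.isOpen_inter_nonempty_of_isOpen hC.isOpen⟩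

theorem IsAlmostZeroDimensional.compactHyperspace {X : Type*} [TopologicalSpace X]
    (hX : IsAlmostZeroDimensional X) : IsAlmostZeroDimensional (CompactHyperspace X) := by
  rw [isAlmostZeroDimensional_iff]
  intro K 𝒰 h𝒰
  obtain ⟨_, ⟨u, ⟨hufin, -, huo⟩, rfl⟩, ⟨hKu, hKU⟩, hu𝒰⟩ :=
    NonemptyCompacts.isTopologicalBasis.mem_nhds_iff.1 h𝒰
  obtain ⟨W, hW, hWu, hKW⟩ :=
    hX.exists_mem_nhdsSet K.isCompact (isOpen_sUnion huo) hKu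
  have hV : ∀ U ∈ u, ∃ V : Set X, IsClopenSeparated V ∧ V ⊆ U ∧
      ((K : Set X) ∩ interior V).Nonempty := by
    intro U hU
    obtain ⟨x, hxK, hxU⟩ := hKU U hU
    obtain ⟨V, hV, hVU, hVs⟩ :=
      isAlmostZeroDimensional_iff.1 hX x U ((huo U hU).mem_nhds hxU)
    exact ⟨V, hVs, hVU, x, hxK, mem_interior_iff_mem_nhds.2 hV⟩
  choose! V hVs hVU hKV using hV
  -- A basic Vietoris neighbourhood with its open sets shrunk to clopen-separated ones.
  refine ⟨{L | (L : Set X) ⊆ W ∧ ∀ U ∈ u, ((L : Set X) ∩ V U).Nonempty}, ?_, ?_, ?_⟩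
  · have h₁ : {L : CompactHyperspace X | (L : Set X) ⊆ interior W} ∈ 𝓝 K :=
      (NonemptyCompacts.isOpen_subsets_of_isOpen isOpen_interior).mem_nhds hKW
    have h₂ : ∀ᶠ L : CompactHyperspace X in 𝓝 K,
        ∀ U ∈ u, ((L : Set X) ∩ interior (V U)).Nonempty :=
      (Filter.eventually_all_finite hufin).2 fun U hU =>
        (NonemptyCompacts.isOpen_inter_nonempty_of_isOpen isOpen_interior).mem_nhds (hKV U hU)
    filter_upwards [h₁, h₂] with L hL₁ hL₂
    exact ⟨Set.Subset.trans hL₁ interior_subset, fun U hU =>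
      (hL₂ U hU).mono (Set.inter_subset_inter_right _ interior_subset)⟩
  · exact fun L hL => hu𝒰 ⟨hL.1.trans hWu, fun U hU =>
      (hL.2 U hU).mono (Set.inter_subset_inter_right _ (hVU U hU))⟩
  · intro L hL
    by_cases hLW : (L : Set X) ⊆ W
    · have : ∃ U ∈ u, ¬ ((L : Set X) ∩ V U).Nonempty := by
        by_contra! h
        exact hL ⟨hLW, h⟩
      obtain ⟨U, hU, hLU⟩ := this
      obtain ⟨D, hD, hVD, hLD⟩ := (hVs U hU).exists_isClopen_disjoint L.isCompact
        (Set.disjoint_iff_inter_eq_empty.2 (Set.not_nonempty_iff_eq_empty.1 hLU))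
      refine ⟨_, isClopen_inter_nonempty_of_isClopen hD, fun M hM =>
        (hM.2 U hU).mono (Set.inter_subset_inter_right _ hVD), ?_⟩
      exact Set.not_nonempty_iff_eq_empty.2 (Set.disjoint_iff_inter_eq_empty.1 hLD)
    · obtain ⟨y, hyL, hyW⟩ := Set.not_subset.1 hLW
      obtain ⟨C, hC, hWC, hyC⟩ := hW y hyW
      exact ⟨_, isClopen_subsets_of_isClopen hC, fun M hM => hM.1.trans hWC,
        fun h => hyC (h hyL)⟩

/-! ### Closed balls in the coordinate spaces -/

/-- The points of `ℓ²` all of whose coordinates lie in `S`. -/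
def coordinateSubspace (S : Set ℝ) : Set HilbertL2 :=
  {x | ∀ i : ℕ, x i ∈ S}

theorem HilbertL2.sum_sq_le_norm_sq (x : HilbertL2) (s : Finset ℕ) :
    ∑ i ∈ s, (x i) ^ 2 ≤ ‖x‖ ^ 2 := by
  simpa using lp.sum_rpow_le_norm_rpow (p := 2) (by simp) x s

theorem HilbertL2.norm_le_of_sum_sq_le {x : HilbertL2} {C : ℝ} (hC : 0 ≤ C)
    (h : ∀ s : Finset ℕ, ∑ i ∈ s, (x i) ^ 2 ≤ C ^ 2) : ‖x‖ ≤ C :=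
  lp.norm_le_of_forall_sum_le (p := 2) (by simp) hC fun s => by simpa using h s

theorem HilbertL2.continuous_apply (i : ℕ) : Continuous fun x : HilbertL2 => x i := by
  refine LipschitzWith.continuous (K := 1) (LipschitzWith.of_dist_le_mul fun x y => ?_)
  simpa [dist_eq_norm] using lp.norm_apply_le_norm (p := 2) (by simp) (x - y) i

theorem isClopen_le_of_notMem_range {X : Type*} [TopologicalSpace X] {g : X → ℝ}
    (hg : Continuous g) {δ : ℝ} (hδ : δ ∉ Set.range g) : IsClopen {y | g y ≤ δ} := by
  refine ⟨isClosed_le hg continuous_const, ?_⟩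
  have : {y | g y ≤ δ} = {y | g y < δ} := by
    ext y
    exact ⟨fun h => lt_of_le_of_ne h fun h' => hδ ⟨y, h'⟩, fun h => le_of_lt (Set.mem_ofPred.1 h)⟩
  rw [this]
  exact isOpen_lt hg continuous_const

theorem isAlmostZeroDimensional_coordinateSubspace {S : Set ℝ} (hS : S.Countable) :
    IsAlmostZeroDimensional (coordinateSubspace S) := by
  rw [isAlmostZeroDimensional_iff]
  intro x U hU
  obtain ⟨ε, hε, hεU⟩ := Metric.nhds_basis_closedBall.mem_iff.1 hU
  refine ⟨Metric.closedBall x ε, Metric.closedBall_mem_nhds x hε, hεU, fun z hz => ?_⟩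
  let g : Finset ℕ → coordinateSubspace S → ℝ := fun s y => ∑ i ∈ s, (y.1 i - x.1 i) ^ 2
  have hg : ∀ s, Continuous (g s) := fun s => continuous_finsetSum _ fun i _ =>
    (((HilbertL2.continuous_apply i).comp continuous_subtype_val).sub continuous_const).pow 2
  have hrange : ∀ s, (Set.range (g s)).Countable := by
    intro s
    have := hS.to_subtype
    refine (Set.countable_range fun v : s → S => ∑ i : s, ((v i : ℝ) - x.1 i) ^ 2).mono ?_
    rintro _ ⟨y, rfl⟩
    exact ⟨fun i => ⟨y.1 i, y.2 i⟩, Finset.sum_coe_sort s fun i => (y.1 i - x.1 i) ^ 2⟩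
  obtain ⟨s, hs⟩ : ∃ s, ε ^ 2 < g s z := by
    by_contra! h
    refine hz ?_
    rw [Metric.mem_closedBall, Subtype.dist_eq, dist_eq_norm]
    exact HilbertL2.norm_le_of_sum_sq_le hε.le fun s => by simpa using h s
  -- A threshold between `ε ^ 2` and `g s z` that `g s` never attains makes the sublevel set clopen.
  obtain ⟨δ, hδ, hδs⟩ := ((hrange s).dense_compl ℝ).exists_between hs
  refine ⟨{y | g s y ≤ δ}, isClopen_le_of_notMem_range (hg s) hδ, fun y hy => ?_,
    not_le.2 hδs.2⟩
  rw [Metric.mem_closedBall, Subtype.dist_eq, dist_eq_norm] at hy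
  refine le_trans ?_ hδs.1.le
  calc g s y ≤ ‖y.1 - x.1‖ ^ 2 := by simpa using HilbertL2.sum_sq_le_norm_sq (y.1 - x.1) s
    _ ≤ ε ^ 2 := by gcongr

/-! ### Unboundedness of clopen sets -/

/-- The step sizes 1/(⌊√n⌋ + 1) tend to zero, lie in `S`, and by this bound are not square summable.
-/
theorem one_div_sq_sqrt_succ_ge (n : ℕ) :
    (1 / 4 : ℝ) * (1 / ((n : ℝ) + 1)) ≤ (1 / ((Nat.sqrt n + 1 : ℕ) : ℝ)) ^ 2 := by
  have h : ((Nat.sqrt n + 1 : ℕ) : ℝ) ^ 2 ≤ 4 * ((n : ℝ) + 1) := by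
    have h₁ := Nat.sqrt_le n
    have h₂ := Nat.sqrt_le_self n
    exact_mod_cast (by nlinarith : (Nat.sqrt n + 1) ^ 2 ≤ 4 * (n + 1))
  rw [one_div_mul_one_div, one_div_pow]
  exact one_div_le_one_div_of_le (by positivity) h

theorem exists_modify_coordinate {S : Set ℝ} (x : coordinateSubspace S) (i : ℕ) {p : ℝ}
    (hp : 0 ≤ p) (hpS : p ∈ S) :
    ∃ y : coordinateSubspace S, (∀ j ≠ i, y.1 j = x.1 j) ∧ p ≤ |y.1 i| ∧ dist y x ≤ 2 * p := by
  by_cases h : p ≤ |x.1 i|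
  · exact ⟨x, fun _ _ => rfl, h, by simpa using hp⟩
  · let y : HilbertL2 := x.1 + lp.single 2 i (p - x.1 i)
    have hi : y i = p := by simp [y]
    have hj : ∀ j ≠ i, y j = x.1 j := fun j hj => by simp [y, hj]
    refine ⟨⟨y, fun j => ?_⟩, hj, ?_, ?_⟩
    · rcases eq_or_ne j i with rfl | hne
      · rwa [hi]
      · rw [hj j hne]
        exact x.2 j
    · change p ≤ |y i|
      rw [hi]
      exact le_abs_self p
    · rw [Subtype.dist_eq, dist_eq_norm, add_sub_cancel_left, lp.norm_single (by simp),
        Real.norm_eq_abs]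
      have := abs_sub p (x.1 i)
      rw [abs_of_nonneg hp] at this
      linarith

open Filter in
/-- Coordinates of a point of a bounded clopen set are greedily enlarged, as long as this does not
leave the set; the limit is a point at distance zero from the complement. -/
theorem IsClopen.not_bounded_coordinateSubspace {S : Set ℝ} (hS : ∀ m : ℕ, 1 ≤ m → 1 / (m : ℝ) ∈ S)
    {C : Set (coordinateSubspace S)} (hC : IsClopen C) (hne : C.Nonempty) (R : ℝ) :
    ∃ x ∈ C, R < ‖x.1‖ := by
  classical
  by_contra! hR
  obtain ⟨a, ha⟩ := hne
  let p : ℕ → ℝ := fun n => 1 / ((Nat.sqrt n + 1 : ℕ) : ℝ)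
  have hp0 : ∀ n, 0 ≤ p n := fun n => by positivity
  have hp : Tendsto p atTop (𝓝 0) := by
    have hsqrt : Tendsto Nat.sqrt atTop atTop :=
      tendsto_atTop.2 fun m => (eventually_ge_atTop (m * m)).mono fun n => Nat.le_sqrt.2
    simpa [p, Function.comp_def] using (tendsto_one_div_add_atTop_nhds_zero_nat (𝕜 := ℝ)).comp hsqrt
  choose step hstep_ne hstep_i hstep_dist using fun (i : ℕ) (x : coordinateSubspace S) =>
    exists_modify_coordinate x i (hp0 i) (hS _ (Nat.le_add_left 1 _))
  let u : ℕ → coordinateSubspace S := fun n => Nat.rec a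
    (fun n x => if step n x ∈ C then step n x else x) n
  have hu_succ : ∀ n, u (n + 1) = if step n (u n) ∈ C then step n (u n) else u n := fun _ => rfl
  have huC : ∀ n, u n ∈ C := by
    intro n
    induction n with
    | zero => exact ha
    | succ n ih =>
      rw [hu_succ]
      split_ifs with h
      exacts [h, ih]
  have hu_ne : ∀ n, ∀ j ≠ n, (u (n + 1)).1 j = (u n).1 j := by
    intro n j hj
    rw [hu_succ]
    split_ifs
    exacts [hstep_ne n _ j hj, rfl]
  let r : ℕ → ℝ := fun j => (u (j + 1)).1 j
  have hu_lt : ∀ n j, j < n → (u n).1 j = r j := by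
    intro n j hj
    induction n, hj using Nat.le_induction with
    | base => rfl
    | succ n hn ih => rw [hu_ne n j (by omega), ih]
  have hu_ge : ∀ n j, n ≤ j → (u n).1 j = a.1 j := by
    intro n j hj
    induction n with
    | zero => rfl
    | succ n ih => rw [hu_ne n j (by omega), ih (by omega)]
  -- Each finite part of `r` is a part of some `u n`, which lies in `C` and so has norm at most `R`.
  have hr : Memℓp (E := fun _ : ℕ => ℝ) r 2 := by
    refine memℓp_gen' (C := R ^ 2) fun s => ?_
    obtain ⟨n, hn⟩ := s.exists_nat_subset_range
    have h₁ : ∑ i ∈ s, (r i) ^ 2 = ∑ i ∈ s, ((u n).1 i) ^ 2 :=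
      Finset.sum_congr rfl fun i hi => by rw [hu_lt n i (Finset.mem_range.1 (hn hi))]
    have h₂ := HilbertL2.sum_sq_le_norm_sq (u n).1 s
    have h₃ : ‖(u n).1‖ ^ 2 ≤ R ^ 2 := pow_le_pow_left₀ (norm_nonneg _) (hR _ (huC n)) 2
    simpa using h₁.le.trans (h₂.trans h₃)
  let b : coordinateSubspace S := ⟨⟨r, hr⟩, fun j => (u (j + 1)).2 j⟩
  have hu_sum : ∀ n, (u n).1 = a.1 + ∑ i ∈ Finset.range n, lp.single 2 i ((b.1 - a.1) i) := by
    intro n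
    ext j
    rw [lp.coeFn_add, Pi.add_apply, lp.coeFn_sum, Finset.sum_apply]
    simp only [lp.coeFn_single, Finset.sum_pi_single, Finset.mem_range]
    split_ifs with h
    · rw [hu_lt n j h]
      change r j = a.1 j + (r j - a.1 j)
      ring
    · rw [hu_ge n j (not_lt.1 h), add_zero]
  have hub : Tendsto u atTop (𝓝 b) := by
    rw [tendsto_subtype_rng]
    simp only [hu_sum]
    have := ((lp.hasSum_single (by simp) (b.1 - a.1)).tendsto_sum_nat).const_add a.1
    simpa using this
  have hbC : b ∈ C := hC.isClosed.mem_of_tendsto hub (Eventually.of_forall huC)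
  -- The attempted enlargements also converge to `b`, as `p n` tends to 0. Since `C` is open, all
  -- late attempts stay in `C` and are accepted, forcing `p n ≤ |r n|` against square summability.
  have hstepb : Tendsto (fun n => step n (u n)) atTop (𝓝 b) := by
    refine (hub.congr_dist ?_)
    refine squeeze_zero (fun _ => dist_nonneg) (fun n => ?_) (by simpa using hp.const_mul 2)
    rw [dist_comm]
    exact hstep_dist n (u n)
  obtain ⟨N, hN⟩ := eventually_atTop.1 (hstepb.eventually (hC.isOpen.mem_nhds hbC))
  have hrp : ∀ n ≥ N, p n ≤ |r n| := by
    intro n hn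
    have : r n = (step n (u n)).1 n := by
      have h : u (n + 1) = step n (u n) := (hu_succ n).trans (if_pos (hN n hn))
      exact congrArg (fun y : coordinateSubspace S => y.1 n) h
    rw [this]
    exact hstep_i n (u n)
  have hsum : Summable fun n => r n ^ 2 := by
    simpa using hr.summable (by simp)
  have hharm : Summable fun n : ℕ => 1 / ((n : ℝ) + 1) := by
    rw [← summable_mul_left_iff (a := (1 / 4 : ℝ)) (by norm_num)]
    refine Summable.of_norm_bounded_eventually_nat hsum ?_
    filter_upwards [eventually_ge_atTop N] with n hn
    rw [Real.norm_of_nonneg (by positivity)]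
    refine (one_div_sq_sqrt_succ_ge n).trans ?_
    rw [← sq_abs (r n)]
    exact pow_le_pow_left₀ (hp0 n) (hrp n hn) 2
  refine Real.not_summable_one_div_natCast ((summable_nat_add_iff 1).1 ?_)
  simpa using hharm

/-! ### Cohesion of the hyperspaces -/

/-- A space over `𝒦(X_S)` in which every point `L` lies on a continuously parametrized copy of `X_S`
along which the parameter belongs to the compact set is cohesive. -/
theorem isCohesive_of_exists_section {S : Set ℝ} (hS : ∀ m : ℕ, 1 ≤ m → 1 / (m : ℝ) ∈ S)
    {Y : Type*} [TopologicalSpace Y] {ι : Y → CompactHyperspace (coordinateSubspace S)}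
    (hι : Continuous ι)
    (h : ∀ L : Y, ∃ φ : coordinateSubspace S → Y, Continuous φ ∧ L ∈ Set.range φ ∧
      ∀ x, x ∈ ι (φ x)) : IsCohesive Y := by
  intro K
  obtain ⟨R, hR⟩ := ((ι K).isCompact.image continuous_subtype_val).isBounded.exists_norm_le
  refine ⟨ι ⁻¹' {L | (L : Set (coordinateSubspace S)) ⊆ {x | ‖x.1‖ < R + 1}}, ?_, ?_⟩
  · refine ((NonemptyCompacts.isOpen_subsets_of_isOpen ?_).preimage hι).mem_nhds ?_
    · exact isOpen_lt continuous_subtype_val.norm continuous_const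
    · intro x hx
      exact (hR x.1 ⟨x, hx, rfl⟩).trans_lt (lt_add_one R)
  · rintro ⟨C, hC, ⟨L, hL⟩, -, hCU⟩
    obtain ⟨φ, hφ, ⟨x, rfl⟩, hφι⟩ := h L
    obtain ⟨y, hy, hyR⟩ :=
      (hC.preimage hφ).not_bounded_coordinateSubspace hS ⟨x, hL⟩ (R + 1)
    exact lt_asymm hyR (hCU hy (hφι y))

theorem isCohesive_compactHyperspace {S : Set ℝ} (hS : ∀ m : ℕ, 1 ≤ m → 1 / (m : ℝ) ∈ S) :
    IsCohesive (CompactHyperspace (coordinateSubspace S)) := by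
  refine isCohesive_of_exists_section hS continuous_id fun L => ?_
  obtain ⟨x, hx⟩ := L.nonempty
  refine ⟨fun y => {y} ⊔ L, by fun_prop, ⟨x, ?_⟩, fun y => ?_⟩
  · exact sup_eq_right.2 (Set.singleton_subset_iff.2 hx)
  · exact Or.inl rfl

theorem isCohesive_finiteHyperspace {S : Set ℝ} (hS : ∀ m : ℕ, 1 ≤ m → 1 / (m : ℝ) ∈ S) :
    IsCohesive (finiteHyperspace (coordinateSubspace S)) := by
  refine isCohesive_of_exists_section hS continuous_subtype_val fun L => ?_
  obtain ⟨x, hx⟩ := L.1.nonempty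
  refine ⟨fun y => ⟨{y} ⊔ L.1, (Set.finite_singleton y).union L.2⟩,
    Continuous.subtype_mk (by fun_prop) _, ⟨x, Subtype.ext ?_⟩, fun y => ?_⟩
  · exact sup_eq_right.2 (Set.singleton_subset_iff.2 hx)
  · exact Or.inl rfl

theorem isCohesive_symmetricProduct {S : Set ℝ} (hS : ∀ m : ℕ, 1 ≤ m → 1 / (m : ℝ) ∈ S)
    {n : ℕ} (hn : 1 ≤ n) : IsCohesive (symmetricProduct n (coordinateSubspace S)) := by
  refine isCohesive_of_exists_section hS continuous_subtype_val fun L => ?_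
  obtain ⟨x, hx⟩ := L.1.nonempty
  have hcard : (L.1 : Set (coordinateSubspace S)).encard ≤ n := L.2
  have hdiff := Set.encard_sdiff_singleton_add_one hx
  -- Replacing `x` by `y`, rather than adding `y`, keeps the cardinality at most `n`; when nothing
  -- remains after removing `x`, singletons are used.
  by_cases hM : ((L.1 : Set (coordinateSubspace S)) \ {x}).Nonempty
  · have hfin : ((L.1 : Set (coordinateSubspace S)) \ {x}).Finite :=
      (Set.finite_of_encard_le_coe hcard).subset Set.sdiff_subset
    let M : CompactHyperspace (coordinateSubspace S) := ⟨⟨_, hfin.isCompact⟩, hM⟩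
    have hyM : ∀ y, {y} ⊔ M ∈ symmetricProduct n (coordinateSubspace S) := by
      intro y
      refine (Set.encard_union_le {y} _).trans ?_
      rw [Set.encard_singleton, add_comm]
      exact hdiff.le.trans hcard
    refine ⟨fun y => ⟨{y} ⊔ M, hyM y⟩, Continuous.subtype_mk (by fun_prop) _,
      ⟨x, Subtype.ext (SetLike.coe_injective ?_)⟩, fun y => Or.inl rfl⟩
    · change {x} ∪ ((L.1 : Set (coordinateSubspace S)) \ {x}) = L.1
      rw [Set.union_sdiff_self, Set.singleton_union, Set.insert_eq_of_mem hx]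
  · have hy : ∀ y, {y} ∈ symmetricProduct n (coordinateSubspace S) := by
      intro y
      change Set.encard {y} ≤ n
      rw [Set.encard_singleton]
      exact_mod_cast hn
    refine ⟨fun y => ⟨{y}, hy y⟩, Continuous.subtype_mk (by fun_prop) _,
      ⟨x, Subtype.ext (SetLike.coe_injective ?_)⟩, fun y => rfl⟩
    · exact Set.Subset.antisymm (Set.singleton_subset_iff.2 hx)
        (Set.sdiff_eq_empty.1 (Set.not_nonempty_iff_eq_empty.1 hM))

/-! ### Specialization to the two Erdős spaces -/

theorem erdosSpace_eq_coordinateSubspace :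
    erdosSpace = coordinateSubspace (Set.range ((↑) : ℚ → ℝ)) := by
  ext x
  simp only [erdosSpace, coordinateSubspace, Set.mem_ofPred_eq, Set.mem_range, eq_comm]

theorem completeErdosSpace_eq_coordinateSubspace :
    completeErdosSpace = coordinateSubspace ({0} ∪ (fun m : ℕ => 1 / (m : ℝ)) '' Set.Ici 1) := by
  ext x
  simp only [completeErdosSpace, coordinateSubspace, Set.mem_ofPred_eq, Set.mem_union,
    Set.mem_singleton_iff, Set.mem_image, Set.mem_Ici, eq_comm (b := x _)]

theorem hyperspaces_coordinateSubspace {S : Set ℝ} (hS : ∀ m : ℕ, 1 ≤ m → 1 / (m : ℝ) ∈ S)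
    (hc : S.Countable) :
    (∀ n : ℕ, 1 ≤ n → IsCohesive (symmetricProduct n (coordinateSubspace S)) ∧
      IsAlmostZeroDimensional (symmetricProduct n (coordinateSubspace S))) ∧
    (IsCohesive (finiteHyperspace (coordinateSubspace S)) ∧
      IsAlmostZeroDimensional (finiteHyperspace (coordinateSubspace S))) ∧
    (IsCohesive (CompactHyperspace (coordinateSubspace S)) ∧
      IsAlmostZeroDimensional (CompactHyperspace (coordinateSubspace S))) := by
  have hK := (isAlmostZeroDimensional_coordinateSubspace hc).compactHyperspace
  exact ⟨fun n hn => ⟨isCohesive_symmetricProduct hS hn, hK.of_isInducing IsInducing.subtypeVal⟩,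
    ⟨isCohesive_finiteHyperspace hS, hK.of_isInducing IsInducing.subtypeVal⟩,
    isCohesive_compactHyperspace hS, hK⟩

theorem mainTheorem8 :
    (∀ n : ℕ, 1 ≤ n →
      (IsCohesive (symmetricProduct n completeErdosSpace) ∧
        IsAlmostZeroDimensional (symmetricProduct n completeErdosSpace)) ∧
      (IsCohesive (symmetricProduct n erdosSpace) ∧
        IsAlmostZeroDimensional (symmetricProduct n erdosSpace))) ∧
    (IsCohesive (finiteHyperspace completeErdosSpace) ∧
      IsAlmostZeroDimensional (finiteHyperspace completeErdosSpace)) ∧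
    (IsCohesive (finiteHyperspace erdosSpace) ∧
      IsAlmostZeroDimensional (finiteHyperspace erdosSpace)) ∧
    (IsCohesive (CompactHyperspace completeErdosSpace) ∧
      IsAlmostZeroDimensional (CompactHyperspace completeErdosSpace)) ∧
    (IsCohesive (CompactHyperspace erdosSpace) ∧
      IsAlmostZeroDimensional (CompactHyperspace erdosSpace)) := by
  rw [erdosSpace_eq_coordinateSubspace, completeErdosSpace_eq_coordinateSubspace]
  obtain ⟨hcn, hcf, hck⟩ := hyperspaces_coordinateSubspace
    (S := {0} ∪ (fun m : ℕ => 1 / (m : ℝ)) '' Set.Ici 1)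
    (fun m hm => Or.inr ⟨m, hm, rfl⟩)
    ((Set.countable_singleton 0).union ((Set.to_countable _).image _))
  obtain ⟨hn, hf, hk⟩ := hyperspaces_coordinateSubspace (S := Set.range ((↑) : ℚ → ℝ))
    (fun m _ => ⟨1 / m, by push_cast; rfl⟩) (Set.countable_range _)
  exact ⟨fun n h => ⟨hcn n h, hn n h⟩, hcf, hf, hck, hk⟩
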